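/- For integers $n\ge 0$ and $k\ge 1$ let $S_{n,k}$ be the finite monogenic inverse monoid defined by the inverse monoid presentation \[ S_{n,k}=\mathrm{Inv}\langle x \mid x^nx^{-n}=x^{n+1}x^{-(n+1)},\ x^nx^{-n}=x^nx^{-n}x^k\rangle. \] A congruence $\rho$ on an inverse semigroup $S$ is called idempotent-pure if $(s,e)\in\rho$ with $e$ idempotent implies that $s$ is idempotent; it is called non-trivial if it is not the equality relation. Theorem. Let $n\ge 0$, $k\ge 1$ and let $\rho$ be a non-trivial congruence on $S_{n,k}$. Then $S_{n,k}/\rho\cong S_{n',k'}$ for some integers $n'\ge 0$, $k'\ge 1$ with $n'\le n$ and $k'\mid k$, and moreover $n'\ge 1$ unless $S_{n,k}/\rho$ is a group. Furthermore, whenever $S_{n,k}/\rho\cong S_{n',k'}$ with $n'\ge 0$ and $k'\ge 1$, the congruence $\rho$ is idempotent-pure if and only if $k'=k$ and $n\le k$. -/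

import Mathlib

/-- The formal inverse of a word in the letters `a` and `a⁻¹`, for `a : α`. The letter `(a, true)`
stands for `a` and `(a, false)` for `a⁻¹`; the word is reversed and every letter is flipped. -/
def formalInv {α : Type*} (w : FreeMonoid (α × Bool)) : FreeMonoid (α × Bool) :=
  FreeMonoid.ofList (FreeGroup.invRev (FreeMonoid.toList w))

/-- The defining relations of the inverse monoid with generators `α` and relations `rels`:
the given relations, and the relations `w w⁻¹ w = w` and `u u⁻¹ v v⁻¹ = v v⁻¹ u u⁻¹`
(for all words `u`, `v`, `w`) which define the free inverse monoid on `α` as a quotient of the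
free monoid on the letters `a` and `a⁻¹`. -/
inductive InvPresRel {α : Type*} (rels : FreeMonoid (α × Bool) → FreeMonoid (α × Bool) → Prop) :
    FreeMonoid (α × Bool) → FreeMonoid (α × Bool) → Prop
  | of_rel {u v : FreeMonoid (α × Bool)} (h : rels u v) : InvPresRel rels u v
  | mul_inv_mul (w : FreeMonoid (α × Bool)) : InvPresRel rels (w * formalInv w * w) w
  | idem_comm (u v : FreeMonoid (α × Bool)) :
      InvPresRel rels (u * formalInv u * (v * formalInv v)) (v * formalInv v * (u * formalInv u))

/-- The inverse monoid `Inv⟨α | rels⟩` defined by an inverse monoid presentation. -/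
abbrev PresentedInverseMonoid {α : Type*}
    (rels : FreeMonoid (α × Bool) → FreeMonoid (α × Bool) → Prop) : Type _ :=
  PresentedMonoid (InvPresRel rels)

namespace MonogenicInverseMonoid

/-- The letter `x`. -/
def x : FreeMonoid (Unit × Bool) := FreeMonoid.of ((), true)

/-- The letter `x⁻¹`. -/
def xInv : FreeMonoid (Unit × Bool) := FreeMonoid.of ((), false)

/-- The two relations `xⁿx⁻ⁿ = xⁿ⁺¹x⁻⁽ⁿ⁺¹⁾` and `xⁿx⁻ⁿ = xⁿx⁻ⁿxᵏ`. -/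
inductive Rel (n k : ℕ) : FreeMonoid (Unit × Bool) → FreeMonoid (Unit × Bool) → Prop
  | index : Rel n k (x ^ n * xInv ^ n) (x ^ (n + 1) * xInv ^ (n + 1))
  | period : Rel n k (x ^ n * xInv ^ n) (x ^ n * xInv ^ n * x ^ k)

end MonogenicInverseMonoid

/-- The monogenic inverse monoid
`S_{n,k} = Inv⟨x | xⁿx⁻ⁿ = xⁿ⁺¹x⁻⁽ⁿ⁺¹⁾, xⁿx⁻ⁿ = xⁿx⁻ⁿxᵏ⟩`. -/
abbrev MonogenicInverseMonoid (n k : ℕ) : Type :=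
  PresentedInverseMonoid (MonogenicInverseMonoid.Rel n k)

/-- A congruence is idempotent-pure if it relates idempotents only to idempotents. -/
def Con.IsIdempotentPure {M : Type*} [Mul M] (ρ : Con M) : Prop :=
  ∀ s e : M, ρ s e → IsIdempotentElem e → IsIdempotentElem s

/-! Write `y` for the inverse of `x`. Every element is some `yᵃ xᶜ yᵇ` with `a, b ≤ c`. Those with
`c ≥ n` form a cyclic group with identity `e = xⁿyⁿ`; below that the triple `(a, c, b)` is unique.
In a quotient take the least index `m` and then the least period `l` satisfied by the generators:
the same normal forms are separated there, so the quotient is `S_{m,l}`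
(`exists_mulEquiv_of_surjective`).

Purity is read off from the exponent sum modulo `k`. If `n ≤ k`, its kernel consists of idempotents
(`isIdempotentElem_of_exponent_eq_one`), and a congruence with `l = k` preserves it. Conversely,
purity applied to `xᵐyᵐxˡ ~ xᵐyᵐ` gives `k ∣ l`. If moreover `k < n`, non-triviality forces `m < n`,
and the non-idempotent `xⁿ⁻¹yⁿ⁻¹xᵏ` (`not_isIdempotentElem`) is related to `xⁿ⁻¹yⁿ⁻¹`. -/

theorem pow_mul_pow_eq_of_index {M : Type*} [Monoid M] {x y : M} {n m : ℕ}
    (h : x ^ n * y ^ n = x ^ (n + 1) * y ^ (n + 1)) (hm : n ≤ m) :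
    x ^ m * y ^ m = x ^ n * y ^ n := by
  induction m, hm using Nat.le_induction with
  | base => rfl
  | succ m _ ih =>
    rw [h, pow_succ', pow_succ y m, mul_assoc, ← mul_assoc (x ^ m), ih, pow_succ',
      pow_succ y n]
    simp only [mul_assoc]

/-! ### Inverse pairs and normal forms. -/

/-- Two elements `x`, `y` of a monoid whose powers are mutually inverse in the sense of inverse
semigroups. -/
structure IsInversePair {M : Type*} [Monoid M] (x y : M) : Prop where
  mul_mul_left : ∀ i : ℕ, x ^ i * y ^ i * x ^ i = x ^ i
  mul_mul_right : ∀ i : ℕ, y ^ i * x ^ i * y ^ i = y ^ i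
  commute : ∀ i j : ℕ, Commute (x ^ i * y ^ i) (y ^ j * x ^ j)

namespace IsInversePair

variable {M : Type*} [Monoid M] {x y : M}

theorem symm (h : IsInversePair x y) : IsInversePair y x where
  mul_mul_left := h.mul_mul_right
  mul_mul_right := h.mul_mul_left
  commute i j := (h.commute j i).symm

theorem rangeIdem_mul_pow (h : IsInversePair x y) {i j : ℕ} (hij : i ≤ j) :
    x ^ i * y ^ i * x ^ j = x ^ j := by
  obtain ⟨d, rfl⟩ := Nat.exists_eq_add_of_le hij
  rw [pow_add, ← mul_assoc, h.mul_mul_left]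

theorem pow_mul_rangeIdem (h : IsInversePair x y) {i j : ℕ} (hij : i ≤ j) :
    y ^ j * (x ^ i * y ^ i) = y ^ j := by
  obtain ⟨d, rfl⟩ := Nat.exists_eq_add_of_le' hij
  rw [pow_add, mul_assoc, ← mul_assoc (y ^ i), h.mul_mul_right]

theorem rangeIdem_mul_of_le (h : IsInversePair x y) {i j : ℕ} (hij : i ≤ j) :
    x ^ i * y ^ i * (x ^ j * y ^ j) = x ^ j * y ^ j := by
  rw [← mul_assoc, h.rangeIdem_mul_pow hij]

theorem mul_rangeIdem_of_le (h : IsInversePair x y) {i j : ℕ} (hij : i ≤ j) :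
    x ^ j * y ^ j * (x ^ i * y ^ i) = x ^ j * y ^ j := by
  rw [mul_assoc, h.pow_mul_rangeIdem hij]

theorem isIdempotentElem (h : IsInversePair x y) (i : ℕ) : IsIdempotentElem (x ^ i * y ^ i) :=
  h.rangeIdem_mul_of_le le_rfl

theorem normalForm_mul (h : IsInversePair x y) {a c b : ℕ} (hb : b ≤ c) :
    ∃ c' b', c ≤ c' ∧ b' ≤ c' ∧
      y ^ a * x ^ c * y ^ b * x = y ^ a * x ^ c' * y ^ b' := by
  rcases b with _ | b
  · exact ⟨c + 1, 0, by omega, by omega, by simp [pow_succ, mul_assoc]⟩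
  · refine ⟨c, b, le_rfl, by omega, ?_⟩
    have h1 : x ^ c * y ^ (b + 1) * x = x ^ c * y ^ b := by
      obtain ⟨d, rfl⟩ := Nat.exists_eq_add_of_le hb
      have := (h.commute b 1).eq
      simp only [pow_one] at this
      calc x ^ (b + 1 + d) * y ^ (b + 1) * x
          = x ^ (d + 1) * ((x ^ b * y ^ b) * (y * x)) := by
            rw [show b + 1 + d = (d + 1) + b by omega, pow_add, pow_succ y]; simp only [mul_assoc]
        _ = x ^ d * (x ^ 1 * y ^ 1 * x ^ 1) * (x ^ b * y ^ b) := by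
            rw [this, pow_succ]; simp only [mul_assoc, pow_one]
        _ = x ^ (b + 1 + d) * y ^ b := by
            rw [h.mul_mul_left, show b + 1 + d = (d + 1) + b by omega, pow_add _ (d + 1),
              pow_succ x d]; simp only [mul_assoc, pow_one]
    rw [mul_assoc (y ^ a), mul_assoc (y ^ a), h1, mul_assoc]

/-- Restores the constraint `b ≤ c` when a normal form with `b = c` is multiplied by `y`: all three
exponents of the new form can be taken one larger. -/
theorem pow_mul_pow_mul_pow (h : IsInversePair x y) {a c : ℕ} (ha : a ≤ c) :
    y ^ (a + 1) * x ^ (c + 1) * y ^ (c + 1) = y ^ a * x ^ c * y ^ (c + 1) := by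
  obtain ⟨d, rfl⟩ := Nat.exists_eq_add_of_le ha
  have e1 : y ^ (a + 1) * x ^ (a + d + 1) * y ^ (a + d + 1) =
      (y ^ (a + 1) * x ^ (a + 1)) * (x ^ d * y ^ d) * y ^ (a + 1) := by
    rw [Nat.add_right_comm a d 1, pow_add x (a + 1) d, Nat.add_comm (a + 1) d, pow_add y d]
    simp only [mul_assoc]
  have e2 : y ^ a * x ^ (a + d) * y ^ (a + d + 1) =
      (y ^ a * x ^ a) * (x ^ d * y ^ d) * y ^ (a + 1) := by
    rw [pow_add x, show a + d + 1 = d + (a + 1) by omega, pow_add y d]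
    simp only [mul_assoc]
  rw [e1, e2, ← (h.commute d (a + 1)).eq, ← (h.commute d a).eq, mul_assoc, mul_assoc,
    h.mul_mul_right, mul_assoc _ (y ^ a * x ^ a), h.symm.rangeIdem_mul_pow (Nat.le_succ a), mul_assoc]

/-- Every product of elements `x`, `y` of an inverse pair has the form `yᵃ xᶜ yᵇ` with `a, b ≤ c`. -/
theorem exists_normalForm (h : IsInversePair x y) {s : M}
    (hs : s ∈ Submonoid.closure {x, y}) :
    ∃ a c b, a ≤ c ∧ b ≤ c ∧ s = y ^ a * x ^ c * y ^ b := by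
  induction hs using Submonoid.closure_induction_right with
  | one => exact ⟨0, 0, 0, le_rfl, le_rfl, by simp⟩
  | mul_right s _ z hz ih =>
    obtain ⟨a, c, b, ha, hb, rfl⟩ := ih
    rcases hz with rfl | rfl
    · obtain ⟨c', b', h2, h3, h4⟩ := h.normalForm_mul (a := a) hb
      exact ⟨a, c', b', by omega, h3, h4⟩
    · rw [mul_assoc _ (z ^ b), ← pow_succ]
      rcases hb.eq_or_lt with rfl | hb
      · exact ⟨a + 1, b + 1, b + 1, by omega, le_rfl, (h.pow_mul_pow_mul_pow ha).symm⟩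
      · exact ⟨a, c, b + 1, ha, hb, rfl⟩

end IsInversePair

/-! ### The minimal ideal and uniqueness of normal forms. -/

/-- An inverse pair satisfying the defining relations of `S_{n,k}`. -/
structure IsMonogenicPair (n k : ℕ) {M : Type*} [Monoid M] (x y : M) : Prop
    extends IsInversePair x y where
  one_le_period : 1 ≤ k
  index : x ^ n * y ^ n = x ^ (n + 1) * y ^ (n + 1)
  period : x ^ n * y ^ n = x ^ n * y ^ n * x ^ k

namespace IsMonogenicPair

variable {n k : ℕ} {M : Type*} [Monoid M] {x y : M}

theorem rangeIdem_eq (h : IsMonogenicPair n k x y) {m : ℕ} (hm : n ≤ m) :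
    x ^ m * y ^ m = x ^ n * y ^ n := pow_mul_pow_eq_of_index h.index hm

theorem idem_mul_left_mul_right (h : IsMonogenicPair n k x y) :
    x ^ n * y ^ n * x * y = x ^ n * y ^ n := by
  rcases n with _ | n
  · simpa using h.index.symm
  · simpa [mul_assoc] using h.mul_rangeIdem_of_le (show 1 ≤ n + 1 by omega)

/-- By the period relation `e = e xᵏ` with `k ≥ 1`, and `xᵏ` absorbs `y x` on the right. -/
theorem idem_mul_right_mul_left (h : IsMonogenicPair n k x y) :
    x ^ n * y ^ n * y * x = x ^ n * y ^ n := by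
  conv_lhs => rw [h.period]
  conv_rhs => rw [h.period]
  have := h.symm.pow_mul_rangeIdem h.one_le_period
  simpa [mul_assoc] using congrArg (x ^ n * y ^ n * ·) this

theorem commute_left (h : IsMonogenicPair n k x y) : Commute (x ^ n * y ^ n) x := by
  have h1 := (h.commute n 1).eq
  simp only [pow_one] at h1
  have h2 : x ^ n * y ^ n = y * x * (x ^ n * y ^ n) := by
    rw [← h1, ← mul_assoc, h.idem_mul_right_mul_left]
  symm
  calc x * (x ^ n * y ^ n) = x * (x ^ n * y ^ n * y * x) := by rw [h.idem_mul_right_mul_left]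
    _ = x ^ (n + 1) * y ^ (n + 1) * x := by rw [pow_succ', pow_succ]; simp only [mul_assoc]
    _ = x ^ n * y ^ n * x := by rw [h.index]

theorem commute_right (h : IsMonogenicPair n k x y) : Commute (x ^ n * y ^ n) y := by
  have h1 := (h.commute n 1).eq
  simp only [pow_one] at h1
  symm
  calc y * (x ^ n * y ^ n) = y * (x ^ n * y ^ n * x * y) := by rw [h.idem_mul_left_mul_right]
    _ = y * x * (x ^ n * y ^ n) * y := by rw [h.commute_left.eq]; simp only [mul_assoc]
    _ = x ^ n * y ^ n * y * x * y := by rw [← h1]; simp only [mul_assoc]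
    _ = x ^ n * y ^ n * y := by rw [h.idem_mul_right_mul_left]

theorem idem_mul_pow_mul_pow (h : IsMonogenicPair n k x y) (m : ℕ) :
    x ^ n * y ^ n * (x ^ m * y ^ m) = x ^ n * y ^ n := by
  rcases le_total m n with hm | hm
  · exact h.mul_rangeIdem_of_le hm
  · rw [h.rangeIdem_mul_of_le hm, h.rangeIdem_eq hm]

theorem idem_mul_pow_mul_pow' (h : IsMonogenicPair n k x y) (m : ℕ) :
    x ^ n * y ^ n * (y ^ m * x ^ m) = x ^ n * y ^ n := by
  induction m with
  | zero => simp
  | succ m ih =>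
    calc x ^ n * y ^ n * (y ^ (m + 1) * x ^ (m + 1))
        = y ^ m * (x ^ n * y ^ n * y * x) * x ^ m := by
          rw [pow_succ, pow_succ', ← mul_assoc, ← mul_assoc, ← mul_assoc,
            (h.commute_right.pow_right m).eq]
          simp only [mul_assoc]
      _ = x ^ n * y ^ n := by
          rw [h.idem_mul_right_mul_left, ← (h.commute_right.pow_right m).eq, mul_assoc, ih]

theorem idem_mul_pow (h : IsMonogenicPair n k x y) {m : ℕ} (hm : n ≤ m) :
    x ^ n * y ^ n * x ^ m = x ^ m := h.rangeIdem_mul_pow hm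

theorem idem_mul_pow_period (h : IsMonogenicPair n k x y) (j : ℕ) :
    x ^ n * y ^ n * x ^ (k * j) = x ^ n * y ^ n := by
  induction j with
  | zero => simp
  | succ j ih => rw [Nat.mul_succ, pow_add, ← mul_assoc, ih, ← h.period]

theorem idem_mul_pow_mod (h : IsMonogenicPair n k x y) (p : ℕ) :
    x ^ n * y ^ n * x ^ p = x ^ n * y ^ n * x ^ (p % k) := by
  conv_lhs => rw [← Nat.div_add_mod p k, pow_add, ← mul_assoc, h.idem_mul_pow_period]

/-- In the group with identity `e`, `y` inverts `x` and `xᵏ` is trivial, so `y` acts as `xᵏ⁻¹`. -/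
theorem idem_mul_pow_right (h : IsMonogenicPair n k x y) (b : ℕ) :
    x ^ n * y ^ n * y ^ b = x ^ n * y ^ n * x ^ ((k - 1) * b) := by
  have e : (k - 1) * b + b = k * b := by
    rw [← Nat.succ_mul, Nat.succ_eq_add_one, Nat.sub_add_cancel h.one_le_period]
  conv_lhs => rw [← h.idem_mul_pow_period b]
  rw [← e, pow_add, ← mul_assoc, (h.commute_left.pow_right ((k - 1) * b)).eq, mul_assoc, mul_assoc,
    h.idem_mul_pow_mul_pow]

/-- The elements `yᵃ xᶜ yᵇ` with `c ≥ n` are of the form `e xᵖ`, with `e` the identity of the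
minimal ideal. -/
theorem exists_eq_idem_mul_pow (h : IsMonogenicPair n k x y) {a c b : ℕ} (hc : n ≤ c) :
    ∃ p, p < k ∧ y ^ a * x ^ c * y ^ b = x ^ n * y ^ n * x ^ p := by
  have e1 : y ^ a * x ^ c * y ^ b =
      x ^ n * y ^ n * x ^ ((k - 1) * a + c + (k - 1) * b) := by
    calc y ^ a * x ^ c * y ^ b = x ^ n * y ^ n * y ^ a * x ^ c * y ^ b := by
          conv_lhs => rw [← h.idem_mul_pow hc, ← mul_assoc (y ^ a),
            ← (h.commute_right.pow_right a).eq]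
      _ = x ^ ((k - 1) * a + c) * (x ^ n * y ^ n * y ^ b) := by
          rw [h.idem_mul_pow_right, mul_assoc _ _ (x ^ c), ← pow_add,
            (h.commute_left.pow_right _).eq, mul_assoc]
      _ = _ := by
          rw [h.idem_mul_pow_right, ← mul_assoc, ← (h.commute_left.pow_right _).eq, mul_assoc,
            ← pow_add]
  exact ⟨_, Nat.mod_lt _ h.one_le_period, e1.trans (h.idem_mul_pow_mod _)⟩

theorem idem_mul_pow_injOn (h : IsMonogenicPair n k x y)
    (hmin : ∀ m < k, 1 ≤ m → x ^ n * y ^ n * x ^ m ≠ x ^ n * y ^ n) {p q : ℕ} (hp : p < k)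
    (hq : q < k) (H : x ^ n * y ^ n * x ^ p = x ^ n * y ^ n * x ^ q) : p = q := by
  wlog hpq : p ≤ q generalizing p q
  · exact (this hq hp H.symm (le_of_not_ge hpq)).symm
  obtain ⟨d, rfl⟩ := Nat.exists_eq_add_of_le' hpq
  by_contra hne
  refine hmin d (by omega) (by omega) ?_
  calc x ^ n * y ^ n * x ^ d = x ^ n * y ^ n * x ^ (d + p) * y ^ p := by
        rw [pow_add, ← mul_assoc, (h.commute_left.pow_right d).eq, mul_assoc, mul_assoc,
          h.idem_mul_pow_mul_pow]
    _ = x ^ n * y ^ n := by rw [← H, mul_assoc, h.idem_mul_pow_mul_pow]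

theorem isUnit_of_index_zero (h : IsMonogenicPair 0 k x y) {s : M}
    (hs : s ∈ Submonoid.closure {x, y}) : IsUnit s := by
  have h1 : x * y = 1 := by simpa using h.idem_mul_left_mul_right
  have h2 : y * x = 1 := by simpa using h.idem_mul_right_mul_left
  induction hs using Submonoid.closure_induction with
  | mem s hs =>
    rcases hs with rfl | rfl
    · exact ⟨⟨_, _, h1, h2⟩, rfl⟩
    · exact ⟨⟨_, _, h2, h1⟩, rfl⟩
  | one => exact isUnit_one
  | mul _ _ _ _ h1 h2 => exact h1.mul h2

/-- If the idempotent `xᶜyᶜ` absorbs `yᵈxᵈ` with `d ≥ 1` then it is in the minimal ideal. -/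
theorem rangeIdem_succ_eq_of_absorbs (h : IsMonogenicPair n k x y) {c d : ℕ} (hd : 1 ≤ d)
    (H : y ^ d * x ^ d * (x ^ c * y ^ c) = x ^ c * y ^ c) :
    x ^ c * y ^ c = x ^ (c + 1) * y ^ (c + 1) := by
  have H1 : y * x * (x ^ c * y ^ c) = x ^ c * y ^ c := by
    rw [← H, ← mul_assoc]
    congr 1
    simpa using h.symm.rangeIdem_mul_of_le hd
  -- The opposite chain `yⁱxⁱ` becomes stationary at `c`, so its value there is `e`; conjugating by
  -- `xᶜ` carries this back to `xᶜyᶜ`.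
  have step : y ^ c * x ^ c = y ^ (c + 1) * x ^ (c + 1) := by
    calc y ^ c * x ^ c = y ^ c * (x ^ c * y ^ c) * x ^ c := by
          rw [← mul_assoc, h.mul_mul_right]
      _ = y ^ (c + 1) * x ^ (c + 1) * (y ^ c * x ^ c) := by
          rw [← H1, pow_succ, pow_succ']; simp only [mul_assoc]
      _ = _ := h.symm.mul_rangeIdem_of_le (Nat.le_succ c)
  have all : ∀ m, c ≤ m → y ^ m * x ^ m = y ^ c * x ^ c := by
    intro m hm
    induction m, hm using Nat.le_induction with
    | base => rfl
    | succ m _ ih =>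
      rw [step, pow_succ', pow_succ, mul_assoc, ← mul_assoc (y ^ m), ih, pow_succ', pow_succ]
      simp only [mul_assoc]
  have low : x ^ n * y ^ n = y ^ c * x ^ c := by
    rw [← all (c + n) (by omega), ← h.idem_mul_pow_mul_pow' (c + n),
      (h.commute n (c + n)).eq, mul_assoc,
      ← (h.commute_left.pow_right (c + n)).eq, h.idem_mul_pow (by omega)]
  have key : x ^ c * y ^ c = x ^ n * y ^ n := by
    calc x ^ c * y ^ c = x ^ c * (y ^ c * x ^ c) * y ^ c := by
          rw [← mul_assoc, h.mul_mul_left]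
      _ = x ^ n * y ^ n := by
          rw [← low, ← (h.commute_left.pow_right c).eq, mul_assoc, h.idem_mul_pow_mul_pow]
  rw [key]
  calc x ^ n * y ^ n = x ^ n * y ^ n * (x ^ (c + 1) * y ^ (c + 1)) :=
        (h.idem_mul_pow_mul_pow _).symm
    _ = _ := by rw [← key, h.rangeIdem_mul_of_le (Nat.le_succ c)]

/-- Multiplying by `xᵃ` and `xᵇ` recovers `xᶜ`. If `a < a'`, then `xᶜ` is fixed by `yᵈxᵈ` with `d =
a' - a`; if `a ≥ a'`, it is fixed by `xᵐyᵐ` for all `m ≤ (a - a') + c'`. Outside the minimal ideal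
the first is impossible and the second forces `(a - a') + c' ≤ c`. -/
theorem normalForm_unique_aux (h : IsMonogenicPair n k x y) {a c b a' c' b' : ℕ}
    (ha : a ≤ c) (hb : b ≤ c) (ha' : a' ≤ c') (hcc : c ≤ c')
    (hc : x ^ c * y ^ c ≠ x ^ (c + 1) * y ^ (c + 1))
    (H : y ^ a * x ^ c * y ^ b = y ^ a' * x ^ c' * y ^ b') : a = a' ∧ c = c' := by
  have H1 : x ^ c = x ^ a * y ^ a' * x ^ c' * y ^ b' * x ^ b := by
    calc x ^ c = x ^ a * (y ^ a * x ^ c * y ^ b) * x ^ b := by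
          have e1 := h.rangeIdem_mul_pow ha
          have e2 := h.symm.pow_mul_rangeIdem hb
          simp only [mul_assoc] at e1 e2 ⊢
          rw [e2, e1]
      _ = _ := by rw [H]; simp only [mul_assoc]
  rcases lt_or_ge a a' with hlt | hge
  · obtain ⟨d, rfl⟩ := Nat.exists_eq_add_of_le hlt.le
    refine absurd (h.rangeIdem_succ_eq_of_absorbs (d := d) (by omega) ?_) hc
    have e : y ^ d * x ^ d * (x ^ a * y ^ (a + d)) = x ^ a * y ^ (a + d) := by
      rw [pow_add, ← mul_assoc (x ^ a), ← mul_assoc, ← (h.commute a d).eq, mul_assoc,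
        h.mul_mul_right]
    have e' : y ^ d * x ^ d * x ^ c = x ^ c := by
      rw [H1]; simp only [← mul_assoc] at e ⊢; rw [e]
    rw [← mul_assoc, e']
  · obtain ⟨d, rfl⟩ := Nat.exists_eq_add_of_le' hge
    have H2 : x ^ c = x ^ (d + c') * y ^ b' * x ^ b := by
      rw [H1, pow_add, pow_add]
      have e := congrArg (x ^ d * · * y ^ b' * x ^ b) (h.rangeIdem_mul_pow ha')
      simpa only [mul_assoc] using e
    by_cases hm : d + c' ≤ c
    · omega
    · refine absurd ?_ hc
      have e : ∀ m ≤ d + c', x ^ m * y ^ m * x ^ c = x ^ c := by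
        intro m hm
        rw [H2, ← mul_assoc, ← mul_assoc, h.rangeIdem_mul_pow hm]
      have := e (c + 1) (by omega)
      calc x ^ c * y ^ c = x ^ (c + 1) * y ^ (c + 1) * (x ^ c * y ^ c) := by
            rw [← mul_assoc, this]
        _ = _ := h.mul_rangeIdem_of_le (Nat.le_succ c)

theorem normalForm_right_unique_aux (h : IsMonogenicPair n k x y) {c b b' : ℕ}
    (hb' : b' ≤ c) (hlt : b < b')
    (H : x ^ c * y ^ b = x ^ c * y ^ b') :
    x ^ c * y ^ c = x ^ (c + 1) * y ^ (c + 1) := by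
  obtain ⟨d, rfl⟩ := Nat.exists_eq_add_of_le hlt.le
  refine h.rangeIdem_succ_eq_of_absorbs (d := d) (by omega) ?_
  have e : x ^ c * y ^ c * y ^ d = x ^ c * y ^ c := by
    obtain ⟨f, rfl⟩ := Nat.exists_eq_add_of_le (show b ≤ c by omega)
    conv_rhs => rw [pow_add y b, ← mul_assoc, H]
    rw [mul_assoc, mul_assoc, ← pow_add, ← pow_add, Nat.add_right_comm]
  calc y ^ d * x ^ d * (x ^ c * y ^ c) = y ^ d * x ^ d * (x ^ c * y ^ c) * y ^ d := by
        conv_lhs => rw [← e, ← mul_assoc]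
    _ = _ := by rw [← (h.commute c d).eq, mul_assoc, h.mul_mul_right, e]

/-- Normal forms `yᵃ xᶜ yᵇ` outside the minimal ideal are unique. -/
theorem normalForm_unique (h : IsMonogenicPair n k x y) {a c b a' c' b' : ℕ}
    (ha : a ≤ c) (hb : b ≤ c) (ha' : a' ≤ c') (hb' : b' ≤ c') (hcc : c ≤ c')
    (hc : x ^ c * y ^ c ≠ x ^ (c + 1) * y ^ (c + 1))
    (H : y ^ a * x ^ c * y ^ b = y ^ a' * x ^ c' * y ^ b') : a = a' ∧ c = c' ∧ b = b' := by
  obtain ⟨rfl, rfl⟩ := h.normalForm_unique_aux ha hb ha' hcc hc H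
  refine ⟨rfl, rfl, ?_⟩
  have H1 : x ^ c * y ^ b = x ^ c * y ^ b' := by
    have := congrArg (x ^ a * ·) H
    simpa only [← mul_assoc, h.rangeIdem_mul_pow ha] using this
  rcases lt_trichotomy b b' with hlt | hlt | hlt
  · exact absurd (h.normalForm_right_unique_aux hb' hlt H1) hc
  · exact hlt
  · exact absurd (h.normalForm_right_unique_aux hb hlt H1.symm) hc

end IsMonogenicPair

/-! ### Presentations and their quotients. -/

namespace MonogenicInverseMonoid

theorem formalInv_mul {α : Type*} (u v : FreeMonoid (α × Bool)) :
    formalInv (u * v) = formalInv v * formalInv u := by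
  simp [formalInv, FreeGroup.invRev_append]

theorem formalInv_pow {α : Type*} (u : FreeMonoid (α × Bool)) (i : ℕ) :
    formalInv (u ^ i) = formalInv u ^ i := by
  induction i with
  | zero => rfl
  | succ i ih => rw [pow_succ, formalInv_mul, ih, pow_succ']

theorem formalInv_x : formalInv x = xInv := rfl

theorem formalInv_xInv : formalInv xInv = x := rfl

/-- The letters `x`, `x⁻¹` map to an inverse pair under any homomorphism respecting the
relations of an inverse monoid presentation. -/
theorem isMonogenicPair_map {T : Type*} [Monoid T] {n k : ℕ} (hk : 1 ≤ k)
    (f : FreeMonoid (Unit × Bool) →* T)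
    (hf : ∀ u v, InvPresRel (Rel n k) u v → f u = f v) : IsMonogenicPair n k (f x) (f xInv) where
  mul_mul_left i := by
    simpa [formalInv_pow, formalInv_x, formalInv_xInv] using hf _ _ (.mul_inv_mul (x ^ i))
  mul_mul_right i := by
    simpa [formalInv_pow, formalInv_xInv] using hf _ _ (.mul_inv_mul (xInv ^ i))
  commute i j := by
    simpa [Commute, SemiconjBy, formalInv_pow, formalInv_x, formalInv_xInv] using hf _ _ (.idem_comm (x ^ i) (xInv ^ j))
  one_le_period := hk
  index := by simpa using hf _ _ (.of_rel .index)
  period := by simpa using hf _ _ (.of_rel .period)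

theorem map_mem_closure {T : Type*} [Monoid T] (f : FreeMonoid (Unit × Bool) →* T)
    (w : FreeMonoid (Unit × Bool)) : f w ∈ Submonoid.closure {f x, f xInv} := by
  induction w with
  | one => simp
  | of a =>
    obtain ⟨⟨⟩, _ | _⟩ := a
    · exact Submonoid.subset_closure (Or.inr rfl)
    · exact Submonoid.subset_closure (Or.inl rfl)
  | mul u v hu hv => rw [map_mul]; exact mul_mem hu hv

theorem isMonogenicPair {n k : ℕ} (hk : 1 ≤ k) :
    IsMonogenicPair n k (PresentedMonoid.mk (InvPresRel (Rel n k)) x)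
      (PresentedMonoid.mk (InvPresRel (Rel n k)) xInv) :=
  isMonogenicPair_map hk _ fun _ _ h => PresentedMonoid.mk_eq_mk_of_rel h

theorem exists_normalForm {n k : ℕ} (hk : 1 ≤ k) (s : MonogenicInverseMonoid n k) :
    ∃ a c b, a ≤ c ∧ b ≤ c ∧ s = PresentedMonoid.mk (InvPresRel (Rel n k))
      (xInv ^ a * x ^ c * xInv ^ b) := by
  obtain ⟨w, rfl⟩ := PresentedMonoid.surjective_mk s
  simpa using (isMonogenicPair hk).exists_normalForm (map_mem_closure _ w)

/-- A homomorphism from words onto a monoid satisfying the relations of `S_{N,K}` induces an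
isomorphism from some `S_{n,k}` with `n ≤ N` and `k ∣ K`. -/
theorem exists_mulEquiv_of_surjective {T : Type*} [Monoid T] {N K : ℕ} (hK : 1 ≤ K)
    (f : FreeMonoid (Unit × Bool) →* T) (hsurj : Function.Surjective f)
    (hf : ∀ u v, InvPresRel (Rel N K) u v → f u = f v) :
    ∃ n k : ℕ, n ≤ N ∧ 1 ≤ k ∧ k ∣ K ∧ ∃ g : MonogenicInverseMonoid n k ≃* T,
      ∀ w, g (PresentedMonoid.mk _ w) = f w := by
  classical
  have hT := isMonogenicPair_map hK f hf
  have hn : ∃ m, f x ^ m * f xInv ^ m = f x ^ (m + 1) * f xInv ^ (m + 1) := ⟨N, hT.index⟩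
  set n := Nat.find hn with n_def
  have hnN : n ≤ N := Nat.find_min' hn hT.index
  have hindex : f x ^ n * f xInv ^ n = f x ^ (n + 1) * f xInv ^ (n + 1) := Nat.find_spec hn
  have hmin : ∀ m < n, f x ^ m * f xInv ^ m ≠ f x ^ (m + 1) * f xInv ^ (m + 1) :=
    fun m hm => Nat.find_min hn hm
  have hnN' : f x ^ N * f xInv ^ N = f x ^ n * f xInv ^ n := by
    exact pow_mul_pow_eq_of_index hindex hnN
  have hk : ∃ m, 1 ≤ m ∧ f x ^ n * f xInv ^ n = f x ^ n * f xInv ^ n * f x ^ m :=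
    ⟨K, hK, by rw [← hnN']; exact hT.period⟩
  set k := Nat.find hk with k_def
  obtain ⟨hk1, hperiod⟩ : 1 ≤ k ∧ f x ^ n * f xInv ^ n = f x ^ n * f xInv ^ n * f x ^ k :=
    Nat.find_spec hk
  have hkmin : ∀ m < k, 1 ≤ m → f x ^ n * f xInv ^ n * f x ^ m ≠ f x ^ n * f xInv ^ n :=
    fun m hm h1 h2 => Nat.find_min hk hm ⟨h1, h2.symm⟩
  have hP : IsMonogenicPair n k (f x) (f xInv) :=
    { hT.toIsInversePair with one_le_period := hk1, index := hindex, period := hperiod }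
  have hkK : k ∣ K := by
    by_contra hdvd
    refine hkmin (K % k) (Nat.mod_lt _ hk1) ?_ ?_
    · exact Nat.pos_of_ne_zero fun h => hdvd (Nat.dvd_of_mod_eq_zero h)
    · rw [← hP.idem_mul_pow_mod, ← hnN', ← hT.period]
  have hf' : ∀ u v, InvPresRel (Rel n k) u v → f u = f v := by
    rintro u v (h | _ | ⟨u, v⟩)
    · cases h
      · simpa using hindex
      · simpa using hperiod
    · exact hf _ _ (.mul_inv_mul v)
    · exact hf _ _ (.idem_comm u v)
  let g : MonogenicInverseMonoid n k →* T := Con.lift _ f (Con.conGen_le.2 hf')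
  have hg : ∀ w, g (PresentedMonoid.mk _ w) = f w := fun w => rfl
  have hS := isMonogenicPair (n := n) hk1
  refine ⟨n, k, hnN, hk1, hkK, MulEquiv.ofBijective g ⟨?_, ?_⟩, hg⟩
  swap
  · intro t
    obtain ⟨w, rfl⟩ := hsurj t
    exact ⟨_, hg w⟩
  intro s t hst
  obtain ⟨a, c, b, ha, hb, rfl⟩ := exists_normalForm hk1 s
  obtain ⟨a', c', b', ha', hb', rfl⟩ := exists_normalForm hk1 t
  wlog hcc : c ≤ c' generalizing a b c a' b' c'
  · exact (this a' c' b' ha' hb' a c b ha hb hst.symm (le_of_not_ge hcc)).symm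
  rw [hg, hg] at hst
  -- Below the minimal index, uniqueness of normal forms applies; from it on, both elements are `e
  -- xᵖ` with `p < k`, separated by minimality of the period.
  rcases lt_or_ge c n with hc | hc
  · simp only [map_mul, map_pow] at hst
    obtain ⟨rfl, rfl, rfl⟩ := hP.normalForm_unique ha hb ha' hb' hcc (hmin c hc) hst
    rfl
  · obtain ⟨p, hp, hp'⟩ := hS.exists_eq_idem_mul_pow (a := a) (b := b) hc
    obtain ⟨q, hq, hq'⟩ := hS.exists_eq_idem_mul_pow (a := a') (b := b') (hc.trans hcc)
    simp only [← map_pow, ← map_mul] at hp' hq'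
    rw [← hg, ← hg, hp', hq', hg, hg] at hst
    simp only [map_mul, map_pow] at hst
    rw [hp', hq', hP.idem_mul_pow_injOn hkmin hp hq hst]


/-! ### The exponent homomorphism. -/

theorem formalInv_of {α : Type*} (a : α) (b : Bool) :
    formalInv (FreeMonoid.of (a, b)) = FreeMonoid.of (a, !b) := rfl

/-- The exponent sum, as a homomorphism to a cyclic group. -/
def wordExponent (k : ℕ) : FreeMonoid (Unit × Bool) →* Multiplicative (ZMod k) :=
  FreeMonoid.lift fun a => Multiplicative.ofAdd (if a.2 then 1 else -1)

theorem wordExponent_formalInv (k : ℕ) (w : FreeMonoid (Unit × Bool)) :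
    wordExponent k (formalInv w) = (wordExponent k w)⁻¹ := by
  induction w with
  | one => exact (map_one _).trans inv_one.symm
  | of a =>
    obtain ⟨a, _ | _⟩ := a <;> simp [formalInv_of, wordExponent]
  | mul u v hu hv => rw [formalInv_mul, map_mul, map_mul, hu, hv, mul_inv]; exact mul_comm _ _

@[simp]
theorem wordExponent_x (k : ℕ) : wordExponent k x = Multiplicative.ofAdd 1 := rfl

@[simp]
theorem wordExponent_xInv (k : ℕ) : wordExponent k xInv = (Multiplicative.ofAdd 1)⁻¹ := rfl

/-- The maximal group image of `S_{n,k}`. -/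
def exponent (n k : ℕ) : MonogenicInverseMonoid n k →* Multiplicative (ZMod k) :=
  Con.lift _ (wordExponent k) <| Con.conGen_le.2 <| by
    rintro u v (h | _ | ⟨u, v⟩)
    · cases h
      · simp [Con.ker_rel]
      · simp [Con.ker_rel, ← ofAdd_nsmul]
    · simp [Con.ker_rel, wordExponent_formalInv]
    · simp [Con.ker_rel, wordExponent_formalInv]

@[simp]
theorem exponent_mk (n k : ℕ) (w : FreeMonoid (Unit × Bool)) :
    exponent n k (PresentedMonoid.mk _ w) = wordExponent k w := rfl

theorem exponent_eq_one_of_isIdempotentElem {n k : ℕ} {s : MonogenicInverseMonoid n k}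
    (hs : IsIdempotentElem s) : exponent n k s = 1 :=
  IsIdempotentElem.iff_eq_one.1 (hs.map (exponent n k))

theorem wordExponent_normalForm (k a c b : ℕ) :
    wordExponent k (xInv ^ a * x ^ c * xInv ^ b) =
      Multiplicative.ofAdd (((c : ℤ) - a - b : ℤ) : ZMod k) := by
  simp only [map_mul, map_pow, wordExponent_x, wordExponent_xInv, ← ofAdd_nsmul, ← ofAdd_neg,
    ← ofAdd_add]
  congr 1
  push_cast
  simp only [nsmul_eq_mul]
  ring

/-- For `c < n` the exponent satisfies `|c - a - b| ≤ c < k`, so it vanishes only if `c = a + b`;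
then `yᵃxᵃ · xᵇyᵇ` is a product of commuting idempotents. -/
theorem isIdempotentElem_of_exponent_eq_one {n k : ℕ} (hk : 1 ≤ k) (hnk : n ≤ k)
    {s : MonogenicInverseMonoid n k} (hs : exponent n k s = 1) : IsIdempotentElem s := by
  have hS := isMonogenicPair (n := n) hk
  obtain ⟨a, c, b, ha, hb, rfl⟩ := exists_normalForm hk s
  rcases lt_or_ge c n with hc | hc
  · rw [exponent_mk, wordExponent_normalForm, ofAdd_eq_one, ZMod.intCast_zmod_eq_zero_iff_dvd] at hs
    have hcab : c = a + b := by
      have := Int.eq_zero_of_abs_lt_dvd hs (by rw [abs_lt]; omega)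
      omega
    have h1 := hS.symm.isIdempotentElem a
    have h2 := hS.isIdempotentElem b
    have := IsIdempotentElem.mul_of_commute (hS.commute b a).symm h1 h2
    rw [hcab]
    simpa [pow_add, mul_assoc] using this
  · obtain ⟨p, hp, hp'⟩ := hS.exists_eq_idem_mul_pow (a := a) (b := b) hc
    simp only [← map_pow, ← map_mul] at hp'
    rw [hp', exponent_mk] at hs
    have : p = 0 := by
      have : k ∣ p := by
        rw [← ZMod.natCast_eq_zero_iff]
        simpa [← ofAdd_nsmul] using hs
      exact Nat.eq_zero_of_dvd_of_lt this hp
    subst this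
    rw [hp']
    simpa using hS.isIdempotentElem n

/-- Both generators map to elements killed by `k`, hence so does every element; a generator of the
cyclic group has order `k'`. -/
theorem period_dvd_of_hom {n k k' : ℕ} (hk : 1 ≤ k)
    (φ : MonogenicInverseMonoid n k →* Multiplicative (ZMod k')) (s : MonogenicInverseMonoid n k)
    (hs : φ s = Multiplicative.ofAdd 1) : k' ∣ k := by
  have hS := isMonogenicPair (n := n) hk
  have h1 : (φ (PresentedMonoid.mk _ x)) ^ k = 1 := by
    simpa using congrArg φ hS.period
  have h2 : (φ (PresentedMonoid.mk _ xInv)) ^ k = 1 := by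
    have := congrArg φ (hS.mul_mul_left 1)
    simp only [pow_one, map_mul, mul_eq_right] at this
    rw [← one_mul (_ ^ k), ← h1, ← mul_pow, this, one_pow, h1]
  have h3 : φ s ^ k = 1 := by
    obtain ⟨w, rfl⟩ := PresentedMonoid.surjective_mk s
    have := map_mem_closure (φ.comp (PresentedMonoid.mk _)) w
    have hle : Submonoid.closure {(φ.comp (PresentedMonoid.mk _)) x,
        (φ.comp (PresentedMonoid.mk _)) xInv} ≤ MonoidHom.mker (powMonoidHom k) := by
      rw [Submonoid.closure_le]
      rintro _ (rfl | rfl)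
      · exact h1
      · exact h2
    exact hle this
  rw [hs, ← ofAdd_nsmul, ofAdd_eq_one, nsmul_one, ZMod.natCast_eq_zero_iff] at h3
  exact h3

theorem period_dvd_of_mulEquiv {n k n' k' : ℕ} (hk : 1 ≤ k)
    (g : MonogenicInverseMonoid n k ≃* MonogenicInverseMonoid n' k') : k' ∣ k :=
  period_dvd_of_hom hk ((exponent n' k').comp g.toMonoidHom) (g.symm (PresentedMonoid.mk _ x))
    (by simp)

/-! ### A representation by partial shifts. -/

/-- Partial bijections of a type form a monoid under composition (from left to right). -/
instance partialBijectionMonoid (α : Type*) : Monoid (α ≃. α) where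
  mul f g := f.trans g
  one := PEquiv.refl α
  mul_assoc := PEquiv.trans_assoc
  one_mul := PEquiv.refl_trans
  mul_one := PEquiv.trans_refl

/-- The partial shift by one on `{0, …, n - 1}`. -/
def shift (n : ℕ) : ℕ ≃. ℕ where
  toFun i := if i + 1 < n then some (i + 1) else none
  invFun j := if 0 < j ∧ j < n then some (j - 1) else none
  inv i j := by
    simp only [Option.ite_none_right_eq_some, Option.some.injEq]
    omega

theorem mem_shift_pow_iff {n m i j : ℕ} : j ∈ (shift n ^ (m + 1)) i ↔ j = i + m + 1 ∧ j < n := by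
  induction m generalizing j with
  | zero =>
    rw [zero_add, pow_one]
    change (if i + 1 < n then some (i + 1) else none) = some j ↔ _
    simp only [Option.ite_none_right_eq_some, Option.some.injEq]
    omega
  | succ m ih =>
    rw [pow_succ]
    change j ∈ (PEquiv.trans _ _) i ↔ _
    rw [PEquiv.mem_trans]
    simp only [ih]
    change (∃ b, _ ∧ (if b + 1 < n then some (b + 1) else none) = some j) ↔ _
    simp only [Option.ite_none_right_eq_some, Option.some.injEq]
    constructor
    · rintro ⟨b, h⟩
      omega
    · intro h
      exact ⟨i + m + 1, by omega⟩

theorem symm_pow {α : Type*} (f : α ≃. α) (m : ℕ) : f.symm ^ m = (f ^ m).symm := by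
  induction m with
  | zero => rfl
  | succ m ih =>
    rw [pow_succ, pow_succ', ih]
    rfl

theorem shift_pow_self {n : ℕ} (hn : 1 ≤ n) : shift n ^ n = ⊥ := by
  obtain ⟨m, rfl⟩ := Nat.exists_eq_add_of_le' hn
  ext i j
  have := mem_shift_pow_iff (n := m + 1) (m := m) (i := i) (j := j)
  simp only [PEquiv.bot_apply]
  rw [Option.mem_def] at this
  simp only [reduceCtorEq, iff_false, this]
  omega

theorem trans_symm_trans {α : Type*} (f : α ≃. α) : (f.trans f.symm).trans f = f := by
  ext i j
  simp only [← Option.mem_def, PEquiv.mem_trans, PEquiv.mem_iff_mem]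
  constructor
  · rintro ⟨b, ⟨c, h1, h2⟩, h3⟩
    obtain rfl := f.inj h1 h2
    exact h3
  · exact fun h => ⟨i, ⟨j, h, h⟩, h⟩

theorem trans_symm_comm {α : Type*} (f g : α ≃. α) :
    (f.trans f.symm).trans (g.trans g.symm) = (g.trans g.symm).trans (f.trans f.symm) := by
  ext i j
  simp only [PEquiv.self_trans_symm, ← Option.mem_def, PEquiv.mem_trans, PEquiv.mem_ofSet_iff]
  constructor <;> rintro ⟨b, ⟨rfl, h1⟩, rfl, h2⟩ <;> exact ⟨_, ⟨rfl, h2⟩, rfl, h1⟩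

/-- The action of words on `{0, …, n - 1}` by partial shifts. -/
def wordShift (n : ℕ) : FreeMonoid (Unit × Bool) →* (ℕ ≃. ℕ) :=
  FreeMonoid.lift fun a => if a.2 then shift n else (shift n).symm

theorem wordShift_formalInv (n : ℕ) (w : FreeMonoid (Unit × Bool)) :
    wordShift n (formalInv w) = (wordShift n w).symm := by
  induction w with
  | one => rfl
  | of a => obtain ⟨a, _ | _⟩ := a <;> simp [formalInv_of, wordShift]
  | mul u v hu hv => rw [formalInv_mul, map_mul, map_mul, hu, hv]; rfl

/-- The shift is nilpotent of index at most `n`, so both sides of each relation become the empty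
map, whatever `k` is. -/
theorem wordShift_respects {n k : ℕ} (hn : 1 ≤ n) (u v : FreeMonoid (Unit × Bool))
    (h : InvPresRel (Rel n k) u v) : wordShift n u = wordShift n v := by
  have hb : ∀ f : ℕ ≃. ℕ, ⊥ * f = ⊥ := fun f => PEquiv.bot_trans f
  obtain h | _ | ⟨u, v⟩ := h
  · have h0 : wordShift n x ^ n = ⊥ := shift_pow_self hn
    cases h <;> simp only [map_mul, map_pow, pow_succ (wordShift n x), h0, hb]
  · simp only [map_mul, wordShift_formalInv]
    exact trans_symm_trans _
  · simp only [map_mul, wordShift_formalInv]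
    exact trans_symm_comm _ _

/-- If `1 ≤ k < n`, the element `xⁿ⁻¹ x⁻⁽ⁿ⁻¹⁾ xᵏ` of `S_{n,k}` is not idempotent. -/
theorem not_isIdempotentElem {n k : ℕ} (hk : 1 ≤ k) (hkn : k < n) :
    ¬ IsIdempotentElem (PresentedMonoid.mk (InvPresRel (Rel n k))
      (x ^ (n - 1) * xInv ^ (n - 1) * x ^ k)) := by
  intro h
  let φ : MonogenicInverseMonoid n k →* (ℕ ≃. ℕ) :=
    Con.lift _ (wordShift n) (Con.conGen_le.2 (wordShift_respects (hk.trans hkn.le)))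
  have h1 : IsIdempotentElem (shift n ^ (n - 1) * (shift n).symm ^ (n - 1) * shift n ^ k) :=
    by simpa only [map_mul, map_pow] using! h.map φ
  -- The image is the single arrow `0 ↦ k`; as `k ≥ 1`, its square is empty.
  have h2 : ∀ i j, j ∈ (shift n ^ (n - 1) * (shift n).symm ^ (n - 1) * shift n ^ k : ℕ ≃. ℕ) i ↔
      i = 0 ∧ j = k := by
    intro i j
    obtain ⟨m, rfl⟩ := Nat.exists_eq_add_of_le' (show 2 ≤ n by omega)
    obtain ⟨k, rfl⟩ := Nat.exists_eq_add_of_le' hk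
    rw [symm_pow]
    change j ∈ (PEquiv.trans (PEquiv.trans _ _) _) i ↔ _
    simp only [PEquiv.mem_trans, PEquiv.mem_iff_mem, show m + 2 - 1 = m + 1 by omega,
      mem_shift_pow_iff]
    constructor
    · rintro ⟨b, ⟨c, h⟩, h'⟩
      omega
    · intro h
      exact ⟨0, ⟨m + 1, by omega⟩, by omega⟩
  have h3 := (h2 0 k).2 ⟨rfl, rfl⟩
  rw [← h1.eq] at h3
  obtain ⟨b, hb, hb'⟩ := (PEquiv.mem_trans _ _ _ _).1 h3
  rw [h2] at hb hb'
  omega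

end MonogenicInverseMonoid

/-! ### The main theorem. -/

open MonogenicInverseMonoid in
theorem mainTheorem6 (n k : ℕ) (hk : 1 ≤ k) (ρ : Con (MonogenicInverseMonoid n k)) (hρ : ρ ≠ ⊥) :
    (∃ n' k' : ℕ, n' ≤ n ∧ ((¬ ∀ a : ρ.Quotient, IsUnit a) → 1 ≤ n') ∧ 1 ≤ k' ∧ k' ∣ k ∧
      Nonempty (ρ.Quotient ≃* MonogenicInverseMonoid n' k')) ∧
    (∀ n' k' : ℕ, 1 ≤ k' → Nonempty (ρ.Quotient ≃* MonogenicInverseMonoid n' k') →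
      (ρ.IsIdempotentPure ↔ k' = k ∧ n ≤ k)) := by
  let f : FreeMonoid (Unit × Bool) →* ρ.Quotient := ρ.mk'.comp (PresentedMonoid.mk _)
  have hsurj : Function.Surjective f :=
    Con.mk'_surjective.comp PresentedMonoid.surjective_mk
  obtain ⟨m, l, hmn, hl, hlk, g, hg⟩ := exists_mulEquiv_of_surjective hk f hsurj
    fun u v h => congrArg ρ.mk' (PresentedMonoid.mk_eq_mk_of_rel h)
  have hT : IsMonogenicPair m l (f x) (f xInv) := isMonogenicPair_map hl f fun u v h => by
    rw [← hg, ← hg, PresentedMonoid.mk_eq_mk_of_rel h]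
  have hrel : ∀ u v, f u = f v → ρ (PresentedMonoid.mk _ u) (PresentedMonoid.mk _ v) :=
    fun u v h => (Con.eq ρ).1 h
  refine ⟨⟨m, l, hmn, fun h => ?_, hl, hlk, ⟨g.symm⟩⟩, fun n' k' hk' ⟨e⟩ => ?_⟩
  · by_contra hm
    obtain rfl : m = 0 := by omega
    refine h fun a => ?_
    obtain ⟨w, rfl⟩ := hsurj a
    exact hT.isUnit_of_index_zero (map_mem_closure f w)
  -- The period is an isomorphism invariant, so the given `k'` may be replaced by the constructed
  -- one.
  obtain rfl : k' = l := Nat.dvd_antisymm (period_dvd_of_mulEquiv hl (g.trans e))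
    (period_dvd_of_mulEquiv hk' (g.trans e).symm)
  constructor
  · intro hpure
    have hkk : k' = k := by
      refine Nat.dvd_antisymm hlk ?_
      have h1 := hpure _ _ (hrel (x ^ m * xInv ^ m * x ^ k') (x ^ m * xInv ^ m)
        (by simpa using hT.period.symm))
        (by simpa using (isMonogenicPair (n := n) hk).isIdempotentElem m)
      have h2 := exponent_eq_one_of_isIdempotentElem h1
      rw [exponent_mk] at h2
      rw [← ZMod.natCast_eq_zero_iff]
      simpa [← ofAdd_nsmul] using h2
    refine ⟨hkk, ?_⟩
    subst hkk
    by_contra! hlt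
    -- With equal periods, `m = n` would make `g` an isomorphism inverting the quotient map, so `ρ`
    -- would be trivial.
    have hm : m < n := by
      refine lt_of_le_of_ne hmn ?_
      rintro rfl
      refine hρ (eq_bot_iff.2 fun a b hab => ?_)
      obtain ⟨u, rfl⟩ := PresentedMonoid.surjective_mk a
      obtain ⟨v, rfl⟩ := PresentedMonoid.surjective_mk b
      have : f u = f v := (Con.eq ρ).2 hab
      rw [← hg, ← hg] at this
      exact g.injective this
    refine not_isIdempotentElem hk hlt (hpure _ _ (hrel _ (x ^ (n - 1) * xInv ^ (n - 1)) ?_) ?_)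
    · simpa [hT.rangeIdem_eq (show m ≤ n - 1 by omega)] using hT.period.symm
    · simpa using (isMonogenicPair (n := n) hk).isIdempotentElem (n - 1)
  · rintro ⟨rfl, hnk⟩ s e hse he
    refine isIdempotentElem_of_exponent_eq_one hk hnk ?_
    rw [← exponent_eq_one_of_isIdempotentElem he]
    obtain ⟨u, rfl⟩ := PresentedMonoid.surjective_mk s
    obtain ⟨v, rfl⟩ := PresentedMonoid.surjective_mk e
    have : f u = f v := (Con.eq ρ).2 hse
    rw [← hg, ← hg] at this
    exact congrArg (exponent m k') (g.injective this)
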